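/- Let $n\ge 1$, let $w:\mathbb{R}^n\to[0,\infty)$, and suppose that $\Sigma:=\{x\in\mathbb{R}^n : w(x)>0\}$ is nonempty, open and convex. Assume that $\log w$ is twice differentiable on $\Sigma$ and satisfies $(\star)\qquad -\nabla^2(\log w)(x)\ge K\,\mathbb{I}$ for all $x\in\Sigma$, for some constant $K>-1$, and let $K_w$ be the largest constant $K$ for which this inequality holds on $\Sigma$. Then $\int_\Sigma w(x)e^{-|x|^2/2}\,dx$ is positive and finite, so that $$d\mu_w=\frac{w(x)e^{-|x|^2/2}\,dx}{\int_\Sigma w(x)e^{-|x|^2/2}\,dx}$$ is a probability measure on $\Sigma$. Let $A$ be the set of all $u\in C_0^\infty(\overline\Sigma)$ (restrictions to $\overline\Sigma$ of compactly supported smooth functions on $\mathbb{R}^n$) such that $\nabla u\cdot\eta=0$ at every point of $\partial\Sigma$ at which $\Sigma$ has a unique outward unit normal $\eta$. For $q\ge 2$ let $W^{1,q}_A(\Sigma,\mu_w)$ be the completion of $A$ with respect to the norm $$\Bigl(\int_\Sigma|u|^q\,d\mu_w\Bigr)^{1/q}+\Bigl(\int_\Sigma|\nabla u|^q\,d\mu_w\Bigr)^{1/q},$$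 that is, the space of $f\in L^q(\mu_w)$ with gradient $\nabla f\in L^q(\mu_w;\mathbb{R}^n)$ for which there are $u_k\in A$ with $u_k\to f$ and $\nabla u_k\to\nabla f$ in $L^q(\mu_w)$. Then, for every real $q\ge 2$ and every $f\in W^{1,q}_A(\Sigma,\mu_w)$, $$\int_\Sigma\Bigl|f-\int_\Sigma f\,d\mu_w\Bigr|^2d\mu_w\le\frac{1}{1+K_w}\Bigl(\int_\Sigma|\nabla f|^q\,d\mu_w\Bigr)^{2/q}.$$ -/

import Mathlib

open scoped ContDiff Topology

noncomputable section

/-- The set `Σ = {x : w x > 0}` on which the weight lives. -/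
def weightSupport {n : ℕ} (w : EuclideanSpace ℝ (Fin n) → ℝ) :
    Set (EuclideanSpace ℝ (Fin n)) :=
  {x | 0 < w x}

/-- The Hessian quadratic form `v ↦ ⟨∇² (log w)(x) v, v⟩`. -/
def hessLog {n : ℕ} (w : EuclideanSpace ℝ (Fin n) → ℝ) (x v : EuclideanSpace ℝ (Fin n)) : ℝ :=
  fderiv ℝ (fderiv ℝ (fun y => Real.log (w y))) x v v

/-- `-∇² (log w(x)) ≥ K · I` (as quadratic forms) for all `x ∈ Σ`. -/
def HessianBound {n : ℕ} (w : EuclideanSpace ℝ (Fin n) → ℝ) (K : ℝ) : Prop :=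
  ∀ x ∈ weightSupport w, ∀ v : EuclideanSpace ℝ (Fin n), K * ‖v‖ ^ 2 ≤ -hessLog w x v

/-- Condition (⋆): `log w` is twice differentiable on `Σ` and
`-∇² (log w) ≥ K · I` on `Σ` for some constant `K > -1`. -/
def StarCondition {n : ℕ} (w : EuclideanSpace ℝ (Fin n) → ℝ) : Prop :=
  (∀ x ∈ weightSupport w, DifferentiableAt ℝ (fun y => Real.log (w y)) x) ∧
  (∀ x ∈ weightSupport w, DifferentiableAt ℝ (fderiv ℝ (fun y => Real.log (w y))) x) ∧
  ∃ K : ℝ, -1 < K ∧ HessianBound w K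

/-- `K_w`, the largest constant `K` with `-∇² (log w) ≥ K · I` on `Σ`
(it is attained, see `isGreatest_curvatureConst`). -/
def curvatureConst {n : ℕ} (w : EuclideanSpace ℝ (Fin n) → ℝ) : ℝ :=
  sSup {K : ℝ | HessianBound w K}

theorem isGreatest_curvatureConst {n : ℕ} (hn : 1 ≤ n) (w : EuclideanSpace ℝ (Fin n) → ℝ)
    (hne : (weightSupport w).Nonempty) (hw : StarCondition w) :
    IsGreatest {K : ℝ | HessianBound w K} (curvatureConst w) := by
  obtain ⟨-, -, K₀, -, hK₀⟩ := hw
  obtain ⟨x₀, hx₀⟩ := hne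
  have hbdd : BddAbove {K : ℝ | HessianBound w K} := by
    refine ⟨-hessLog w x₀ (EuclideanSpace.single ⟨0, hn⟩ 1), fun K hK => ?_⟩
    have h := hK x₀ hx₀ (EuclideanSpace.single ⟨0, hn⟩ 1)
    simpa using h
  refine ⟨fun x hx v => ?_, fun K hK => le_csSup hbdd hK⟩
  rcases eq_or_ne v 0 with rfl | hv
  · simpa using hK₀ x hx 0
  · have hpos : 0 < ‖v‖ ^ 2 := by positivity
    rw [← le_div_iff₀ hpos]
    exact csSup_le ⟨K₀, hK₀⟩ fun K hK => (le_div_iff₀ hpos).2 (hK x hx v)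

/-- The measure `w(x) exp(-|x|²/2) dx` on `Σ`, before normalization. -/
def unnormalizedMeasure {n : ℕ} (w : EuclideanSpace ℝ (Fin n) → ℝ) :
    MeasureTheory.Measure (EuclideanSpace ℝ (Fin n)) :=
  (MeasureTheory.volume.restrict (weightSupport w)).withDensity
    fun x => ENNReal.ofReal (w x * Real.exp (-‖x‖ ^ 2 / 2))

/-- The weighted Gaussian measure
`dμ_w = w(x) exp(-|x|²/2) dx / ∫_Σ w(x) exp(-|x|²/2) dx`. -/
def weightedGaussian {n : ℕ} (w : EuclideanSpace ℝ (Fin n) → ℝ) :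
    MeasureTheory.Measure (EuclideanSpace ℝ (Fin n)) :=
  (unnormalizedMeasure w Set.univ)⁻¹ • unnormalizedMeasure w

/-- `η` is an outward unit normal of the convex set `S` at `x`: the half-space with outward
unit normal `η` whose boundary passes through `x` contains `S`. -/
def IsOutwardUnitNormal {n : ℕ} (S : Set (EuclideanSpace ℝ (Fin n)))
    (x η : EuclideanSpace ℝ (Fin n)) : Prop :=
  ‖η‖ = 1 ∧ ∀ y ∈ S, inner ℝ η (y - x) ≤ 0

/-- The class `A` of functions `u ∈ C_0^∞(closure S)` with `∇u · η = 0` on `∂S`, for an open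
convex set `S`. Functions that are smooth up to the boundary and have compact support are taken
as (restrictions to `closure S` of) smooth compactly supported functions on `ℝⁿ`; their support
may meet `∂S`. The boundary condition is imposed at each boundary point at which `S` has
an outer normal, that is, exactly one outward unit normal (so not at corners and edges). -/
def IsNeumannTest {n : ℕ} (S : Set (EuclideanSpace ℝ (Fin n)))
    (u : EuclideanSpace ℝ (Fin n) → ℝ) : Prop :=
  ContDiff ℝ ∞ u ∧ HasCompactSupport u ∧
  ∀ x ∈ frontier S, ∀ η : EuclideanSpace ℝ (Fin n),
    IsOutwardUnitNormal S x η → (∀ η', IsOutwardUnitNormal S x η' → η' = η) →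
    inner ℝ (gradient u x) η = 0

/-- `f ∈ W^{1,q}_A(Σ, μ_w)` with gradient `∇f = g`. The completion of `A` for the norm
`‖u‖_{L^q(μ_w)} + ‖∇u‖_{L^q(μ_w)}` is realized as the closure of `{(u, ∇u) : u ∈ A}` in
`L^q(μ_w) × L^q(μ_w; ℝⁿ)`: there are `u_k ∈ A` with `u_k → f` and `∇u_k → g` in `L^q(μ_w)`. -/
def IsSobolevWithGradient {n : ℕ} (w : EuclideanSpace ℝ (Fin n) → ℝ) (q : ℝ)
    (f : EuclideanSpace ℝ (Fin n) → ℝ)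
    (g : EuclideanSpace ℝ (Fin n) → EuclideanSpace ℝ (Fin n)) : Prop :=
  MeasureTheory.MemLp f (ENNReal.ofReal q) (weightedGaussian w) ∧
  MeasureTheory.MemLp g (ENNReal.ofReal q) (weightedGaussian w) ∧
  ∃ u : ℕ → EuclideanSpace ℝ (Fin n) → ℝ,
    (∀ k, IsNeumannTest (weightSupport w) (u k)) ∧
    Filter.Tendsto
      (fun k => MeasureTheory.eLpNorm (fun x => u k x - f x) (ENNReal.ofReal q)
        (weightedGaussian w)) Filter.atTop (𝓝 0) ∧
    Filter.Tendsto
      (fun k => MeasureTheory.eLpNorm (fun x => gradient (u k) x - g x) (ENNReal.ofReal q)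
        (weightedGaussian w)) Filter.atTop (𝓝 0)

end

/-! Extended by zero, the density `w x * exp(-‖x‖²/2)` is strongly log-concave on all of `ℝⁿ` with
constant `lam = 1 + K_w`: the Gaussian factor adds `1` to the curvature, and convexity of `Σ` takes
care of the points outside it. Hence no boundary term ever appears.

The Poincaré inequality then follows from Prékopa–Leindler, by Maurey's route. If `φ x + ψ y ≤ lam /
4 * ‖x - y‖²`, Prékopa–Leindler applied to the tilted densities gives `(∫ exp φ) * (∫ exp ψ) ≤ 1`.
For `u` centred and `κ > 1 / lam`, the pair `φ = t u - t² κ ‖∇u‖²`, `ψ = -t u` is admissible for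
small `t > 0`; the `t²` terms of the product give `∫ u² ≤ κ ∫ ‖∇u‖²`, and `κ` decreases to `1 / lam`
(`poincare_of_midpoint_strongly_logConcave`). Approximation by test functions carries this to the
Sobolev class, and monotonicity of `L^p` norms on a probability space replaces the exponent `2` of
the gradient by `q`. -/

/-! ### Brunn–Minkowski and Prékopa–Leindler on the line. -/

open MeasureTheory Set in
/-- One-dimensional Brunn–Minkowski inequality for compact sets, in midpoint form. -/
theorem volume_add_volume_le_of_isCompact {A B C : Set ℝ} (hA : IsCompact A) (hB : IsCompact B)
    (hAn : A.Nonempty) (hBn : B.Nonempty)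
    (h : ∀ a ∈ A, ∀ b ∈ B, (a + b) / 2 ∈ C) :
    volume A + volume B ≤ 2 * volume C := by
  obtain ⟨a, haA, ha⟩ := hA.exists_isGreatest hAn
  obtain ⟨b, hbB, hb⟩ := hB.exists_isLeast hBn
  have hvC : volume ((fun x : ℝ => (1 / 2) * x) ⁻¹' C) = 2 * volume C := by
    rw [Real.volume_preimage_mul_left (by norm_num)]
    norm_num
  -- With `a = max A` and `b = min B`, the translates `A + b` and `B + a` both lie in `2C` and meet
  -- at most at `a + b`.
  have h1 : volume ((fun x => x + (-b)) ⁻¹' A) = volume A := measure_preimage_add_right _ _ _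
  have h2 : volume ((fun x => x + (-a)) ⁻¹' B) = volume B := measure_preimage_add_right _ _ _
  have hmB : MeasurableSet ((fun x => x + (-a)) ⁻¹' B) :=
    (measurable_add_const _) hB.measurableSet
  rw [← hvC, ← h1, ← h2, ← measure_union₀ hmB.nullMeasurableSet]
  · refine measure_mono (union_subset (fun x hx => ?_) fun x hx => ?_)
    · have := h _ hx b hbB
      simp only [mem_preimage]
      convert this using 1
      ring
    · have := h a haA _ hx
      simp only [mem_preimage]
      convert this using 1
      ring
  · refine measure_mono_null (t := {a + b}) (fun x hx => ?_) (by simp)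
    have := ha hx.1
    have := hb hx.2
    simp only [mem_singleton_iff]
    linarith

open MeasureTheory Set in
/-- One-dimensional Brunn–Minkowski inequality, in midpoint form. -/
theorem volume_add_volume_le_of_midpoint_mem {A B C : Set ℝ} (hA : MeasurableSet A)
    (hB : MeasurableSet B) (hAn : A.Nonempty) (hBn : B.Nonempty)
    (h : ∀ a ∈ A, ∀ b ∈ B, (a + b) / 2 ∈ C) :
    volume A + volume B ≤ 2 * volume C := by
  obtain ⟨a, ha⟩ := hAn
  obtain ⟨b, hb⟩ := hBn
  have key : ∀ S : Set ℝ, MeasurableSet S →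
      volume S = ⨆ K : {K : Set ℝ // K ⊆ S ∧ IsCompact K}, volume K.1 := fun S hS => by
    rw [hS.measure_eq_iSup_isCompact, iSup_subtype]
    simp only [iSup_and]
  rw [key A hA, key B hB]
  have : Nonempty {K : Set ℝ // K ⊆ A ∧ IsCompact K} := ⟨⟨∅, by simp⟩⟩
  have : Nonempty {K : Set ℝ // K ⊆ B ∧ IsCompact K} := ⟨⟨∅, by simp⟩⟩
  refine ENNReal.iSup_add_iSup_le fun K L => ?_
  -- The approximating compact sets may be empty; adjoining one point of `A` and of `B` makes them
  -- nonempty.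
  calc volume K.1 + volume L.1 ≤ volume (insert a K.1) + volume (insert b L.1) := by
        gcongr <;> exact subset_insert _ _
    _ ≤ _ := volume_add_volume_le_of_isCompact (K.2.2.insert a) (L.2.2.insert b)
        (insert_nonempty _ _) (insert_nonempty _ _) fun x hx y hy =>
          h x (insert_subset ha K.2.1 hx) y (insert_subset hb L.2.1 hy)

-- Layer cake formula. Levels `r ≥ 1` contribute nothing, which leaves exactly the range where
-- superlevel sets of a function with supremum one are nonempty.
open MeasureTheory Set in
theorem lintegral_ofReal_eq_setLIntegral_Ioo {u : ℝ → ℝ} (hu : Measurable u) (hu0 : ∀ x, 0 ≤ u x)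
    (hu1 : ∀ x, u x ≤ 1) :
    ∫⁻ x, ENNReal.ofReal (u x) = ∫⁻ r in Ioo (0 : ℝ) 1, volume {x | r < u x} := by
  rw [lintegral_eq_lintegral_meas_lt _ (Filter.Eventually.of_forall hu0) hu.aemeasurable,
    ← Ioo_union_Ici_eq_Ioi (zero_lt_one' ℝ), lintegral_union measurableSet_Ici]
  · rw [setLIntegral_congr_fun (g := fun _ => 0) measurableSet_Ici]
    · simp
    · intro r hr
      have : {x | r < u x} = ∅ := by
        ext x
        simpa using (hu1 x).trans hr
      simp [this]
  · exact disjoint_left.2 fun x hx hx' => not_lt.2 hx' hx.2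

open MeasureTheory Set in
/-- The one-dimensional Prékopa–Leindler inequality for functions with supremum one. -/
theorem lintegral_add_lintegral_le_of_iSup_eq_one {u v m : ℝ → ℝ} (hu : Measurable u)
    (hv : Measurable v) (hm : Measurable m) (hu0 : ∀ x, 0 ≤ u x) (hv0 : ∀ x, 0 ≤ v x)
    (hm0 : ∀ x, 0 ≤ m x) (hu1 : ∀ x, u x ≤ 1) (hv1 : ∀ x, v x ≤ 1)
    (hus : ∀ r < 1, ∃ x, r < u x) (hvs : ∀ r < 1, ∃ x, r < v x)
    (h : ∀ x y, u x * v y ≤ m ((x + y) / 2) ^ 2) :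
    (∫⁻ x, ENNReal.ofReal (u x)) + (∫⁻ x, ENNReal.ofReal (v x)) ≤
      2 * ∫⁻ x, ENNReal.ofReal (m x) := by
  have hanti : ∀ f : ℝ → ℝ, Measurable fun r : ℝ => volume {x | r < f x} := fun f =>
    Antitone.measurable fun r s hrs => measure_mono fun x hx => lt_of_le_of_lt hrs hx
  rw [lintegral_ofReal_eq_setLIntegral_Ioo hu hu0 hu1,
    lintegral_ofReal_eq_setLIntegral_Ioo hv hv0 hv1, ← lintegral_add_left (hanti u)]
  calc _ ≤ ∫⁻ r in Ioo (0 : ℝ) 1, 2 * volume {x | r < m x} := by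
        refine setLIntegral_mono ((hanti m).const_mul 2) fun r hr => ?_
        -- Brunn–Minkowski needs both superlevel sets nonempty at every level `r < 1`; this is why
        -- the suprema are normalized.
        refine volume_add_volume_le_of_midpoint_mem (measurableSet_lt measurable_const hu)
          (measurableSet_lt measurable_const hv) (hus r hr.2) (hvs r hr.2) fun a ha b hb => ?_
        simp only [mem_ofPred_eq] at *
        refine lt_of_pow_lt_pow_left₀ 2 (hm0 _) (lt_of_lt_of_le ?_ (h a b))
        nlinarith [hr.1]
    _ = 2 * ∫⁻ r in Ioo (0 : ℝ) 1, volume {x | r < m x} := lintegral_const_mul _ (hanti m)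
    _ ≤ _ := by
        rw [lintegral_eq_lintegral_meas_lt _ (Filter.Eventually.of_forall hm0) hm.aemeasurable]
        gcongr
        exact Ioo_subset_Ioi_self

/-- The arithmetic–geometric mean inequality, turning the additive bound into the multiplicative
one. -/
theorem ENNReal.mul_le_sq_of_add_le {a b c : ENNReal} (h : a + b ≤ 2 * c) : a * b ≤ c ^ 2 := by
  rcases eq_or_ne c ⊤ with rfl | hc
  · simp
  have hc2 : 2 * c ≠ ⊤ := ENNReal.mul_ne_top (by simp) hc
  have ha : a ≠ ⊤ := ne_top_of_le_ne_top hc2 (le_self_add.trans h)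
  have hb : b ≠ ⊤ := ne_top_of_le_ne_top hc2 (le_add_self.trans h)
  lift a to NNReal using ha
  lift b to NNReal using hb
  lift c to NNReal using hc
  norm_cast at *
  rw [← NNReal.coe_le_coe] at *
  push_cast at *
  nlinarith [sq_nonneg ((a : ℝ) - b), a.2, b.2, c.2]

open MeasureTheory Set in
/-- The one-dimensional Prékopa–Leindler inequality for bounded functions. -/
theorem lintegral_mul_lintegral_le_of_bounded {u v m : ℝ → ℝ} (hu : Measurable u)
    (hv : Measurable v) (hm : Measurable m) (hu0 : ∀ x, 0 ≤ u x) (hv0 : ∀ x, 0 ≤ v x)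
    (hm0 : ∀ x, 0 ≤ m x) (hub : BddAbove (range u)) (hvb : BddAbove (range v))
    (h : ∀ x y, u x * v y ≤ m ((x + y) / 2) ^ 2) :
    (∫⁻ x, ENNReal.ofReal (u x)) * (∫⁻ x, ENNReal.ofReal (v x)) ≤
      (∫⁻ x, ENNReal.ofReal (m x)) ^ 2 := by
  set a := ⨆ x, u x
  set b := ⨆ x, v x
  have hua : ∀ x, u x ≤ a := le_ciSup hub
  have hvb' : ∀ x, v x ≤ b := le_ciSup hvb
  rcases ((hu0 0).trans (hua 0)).eq_or_lt with ha | ha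
  · have : ∀ x, u x = 0 := fun x => le_antisymm (ha ▸ hua x) (hu0 x)
    simp [this]
  rcases ((hv0 0).trans (hvb' 0)).eq_or_lt with hb | hb
  · have : ∀ x, v x = 0 := fun x => le_antisymm (hb ▸ hvb' x) (hv0 x)
    simp [this]
  have hab : 0 < √(a * b) := Real.sqrt_pos.2 (mul_pos ha hb)
  -- Dividing `u`, `v`, `m` by `a`, `b`, `√(a * b)` preserves the hypothesis, and the multiplicative
  -- conclusion is homogeneous.
  have key := ENNReal.mul_le_sq_of_add_le <| lintegral_add_lintegral_le_of_iSup_eq_one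
    (u := fun x => a⁻¹ * u x)
    (v := fun x => b⁻¹ * v x) (m := fun x => (√(a * b))⁻¹ * m x) (hu.const_mul _) (hv.const_mul _)
    (hm.const_mul _) (fun x => mul_nonneg (inv_nonneg.2 ha.le) (hu0 x))
    (fun x => mul_nonneg (inv_nonneg.2 hb.le) (hv0 x))
    (fun x => mul_nonneg (inv_nonneg.2 hab.le) (hm0 x))
    (fun x => (inv_mul_le_one₀ ha).2 (hua x)) (fun x => (inv_mul_le_one₀ hb).2 (hvb' x))
    (fun r hr => by
      obtain ⟨x, hx⟩ := exists_lt_of_lt_ciSup (show a * r < a by nlinarith)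
      exact ⟨x, (lt_inv_mul_iff₀ ha).2 hx⟩)
    (fun r hr => by
      obtain ⟨x, hx⟩ := exists_lt_of_lt_ciSup (show b * r < b by nlinarith)
      exact ⟨x, (lt_inv_mul_iff₀ hb).2 hx⟩)
    (fun x y => by
      rw [mul_pow, inv_pow, Real.sq_sqrt (mul_pos ha hb).le, mul_inv]
      calc _ = a⁻¹ * b⁻¹ * (u x * v y) := by ring
        _ ≤ _ := mul_le_mul_of_nonneg_left (h x y) (by positivity))
  have hs : ∀ (c : ℝ) (f : ℝ → ℝ), 0 < c → Measurable f →
      ∫⁻ x, ENNReal.ofReal (f x) = ENNReal.ofReal c * ∫⁻ x, ENNReal.ofReal (c⁻¹ * f x) := by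
    intro c f hc hf
    rw [← lintegral_const_mul _ (hf.const_mul _).ennreal_ofReal]
    refine lintegral_congr fun x => ?_
    rw [← ENNReal.ofReal_mul hc.le, mul_inv_cancel_left₀ hc.ne']
  rw [hs a u ha hu, hs b v hb hv, hs _ m hab hm, mul_pow, ← ENNReal.ofReal_pow hab.le,
    Real.sq_sqrt (mul_pos ha hb).le, ENNReal.ofReal_mul ha.le, mul_mul_mul_comm]
  gcongr

open MeasureTheory Set in
/-- The one-dimensional Prékopa–Leindler inequality. -/
theorem lintegral_mul_lintegral_le_real {u v m : ℝ → ENNReal} (hu : Measurable u)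
    (hv : Measurable v) (hm : Measurable m)
    (h : ∀ x y, u x * v y ≤ m ((x + y) / 2) ^ 2) :
    (∫⁻ x, u x) * (∫⁻ x, v x) ≤ (∫⁻ x, m x) ^ 2 := by
  have htrunc : ∀ f : ℝ → ENNReal, Measurable f →
      ∫⁻ x, f x = ⨆ N : ℕ, ∫⁻ x, min (f x) N := fun f hf => by
    rw [← lintegral_iSup (fun N => hf.min measurable_const)
      fun i j hij x => min_le_min_left _ (by exact_mod_cast hij)]
    refine lintegral_congr fun x => ?_
    rw [← inf_iSup_eq, ENNReal.iSup_natCast, inf_top_eq]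
  have hmono : ∀ f : ℝ → ENNReal, Monotone fun N : ℕ => ∫⁻ x, min (f x) N := fun f i j hij =>
    lintegral_mono fun x => min_le_min_left _ (by exact_mod_cast hij)
  have hreal : ∀ (f : ℝ → ENNReal) (N : ℕ),
      ∫⁻ x, min (f x) N = ∫⁻ x, ENNReal.ofReal (min (f x) N).toReal := fun f N =>
    lintegral_congr fun x => (ENNReal.ofReal_toReal
      (ne_top_of_le_ne_top (ENNReal.natCast_ne_top N) (min_le_right _ _))).symm
  rw [htrunc u hu, htrunc v hv]
  have hN : ∀ N : ℕ, (∫⁻ x, min (u x) N) * (∫⁻ x, min (v x) N) ≤ (∫⁻ x, m x) ^ 2 := fun N => by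
    have hb : ∀ f : ℝ → ENNReal, BddAbove (range fun x => (min (f x) N).toReal) := fun f => by
      refine ⟨N, ?_⟩
      rintro _ ⟨x, rfl⟩
      exact ENNReal.toReal_le_of_le_ofReal (Nat.cast_nonneg N) (by simp)
    have hlt : ∀ f : ℝ → ENNReal, ∀ x, min (f x) N ≠ ⊤ := fun f x =>
      ne_top_of_le_ne_top (ENNReal.natCast_ne_top N) (min_le_right _ _)
    rw [hreal u, hreal v]
    refine (lintegral_mul_lintegral_le_of_bounded (m := fun x => (min (m x) N).toReal)
      (hu.min measurable_const).ennreal_toReal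
      (hv.min measurable_const).ennreal_toReal (hm.min measurable_const).ennreal_toReal
      (fun _ => ENNReal.toReal_nonneg) (fun _ => ENNReal.toReal_nonneg)
      (fun _ => ENNReal.toReal_nonneg) (hb u) (hb v) fun x y => ?_).trans ?_
    · rw [← ENNReal.toReal_mul, ← ENNReal.toReal_pow]
      refine ENNReal.toReal_mono (ENNReal.pow_ne_top (hlt m _)) ?_
      -- Truncating all three functions at the same height `N` preserves the hypothesis.
      rcases le_total (m ((x + y) / 2)) N with hle | hle
      · rw [min_eq_left hle]
        exact (mul_le_mul' (min_le_left _ _) (min_le_left _ _)).trans (h x y)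
      · rw [min_eq_right hle, sq]
        exact mul_le_mul' (min_le_right _ _) (min_le_right _ _)
    · rw [← hreal m]
      gcongr
      exact min_le_left _ _
  rw [ENNReal.iSup_mul]
  refine iSup_le fun i => ?_
  rw [ENNReal.mul_iSup]
  refine iSup_le fun j => ?_
  exact (mul_le_mul' (hmono u (le_max_left i j)) (hmono v (le_max_right i j))).trans (hN (max i j))

/-! ### Prékopa–Leindler in dimension `n`. -/

open MeasureTheory in
/-- The Prékopa–Leindler inequality for midpoints in `ι → ℝ` with `ι = Fin n`. -/
theorem lintegral_mul_lintegral_le_pi (n : ℕ) {u v m : (Fin n → ℝ) → ENNReal} (hu : Measurable u)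
    (hv : Measurable v) (hm : Measurable m)
    (h : ∀ x y, u x * v y ≤ m ((1 / 2 : ℝ) • (x + y)) ^ 2) :
    (∫⁻ x, u x) * (∫⁻ x, v x) ≤ (∫⁻ x, m x) ^ 2 := by
  induction n with
  | zero =>
    simp only [volume_pi]
    simpa [Subsingleton.elim _ (isEmptyElim : Fin 0 → ℝ)] using
      h (isEmptyElim : Fin 0 → ℝ) (isEmptyElim : Fin 0 → ℝ)
  | succ n ih =>
    let e := (MeasurableEquiv.piFinSuccAbove (fun _ : Fin (n + 1) => ℝ) 0).symm
    have he : MeasurePreserving e volume volume :=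
      (volume_preserving_piFinSuccAbove (fun _ : Fin (n + 1) => ℝ) 0).symm
    have hI : ∀ f : (Fin (n + 1) → ℝ) → ENNReal, Measurable f →
        ∫⁻ x, f x = ∫⁻ s : ℝ, ∫⁻ y : Fin n → ℝ, f (e (s, y)) := fun f hf => by
      rw [← he.lintegral_comp hf, Measure.volume_eq_prod]
      exact lintegral_prod _ (hf.comp e.measurable).aemeasurable
    have hM : ∀ f : (Fin (n + 1) → ℝ) → ENNReal, Measurable f →
        Measurable fun s : ℝ => ∫⁻ y : Fin n → ℝ, f (e (s, y)) := fun f hf =>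
      (hf.comp e.measurable).lintegral_prod_right'
    have hS : ∀ f : (Fin (n + 1) → ℝ) → ENNReal, Measurable f → ∀ s : ℝ,
        Measurable fun y : Fin n → ℝ => f (e (s, y)) := fun f hf s =>
      hf.comp (e.measurable.comp measurable_prodMk_left)
    rw [hI u hu, hI v hv, hI m hm]
    -- The slice integrals satisfy the one-dimensional hypothesis: this is the `n`-dimensional
    -- inequality for the slices at `s`, `t` and `(s + t) / 2`.
    refine lintegral_mul_lintegral_le_real (hM u hu) (hM v hv) (hM m hm) fun s t => ?_
    refine ih (hS u hu s) (hS v hv t) (hS m hm _) fun x y => ?_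
    refine (h (e (s, x)) (e (t, y))).trans_eq ?_
    congr 2
    ext i
    refine Fin.cases ?_ (fun j => ?_) i
    · simp [e, MeasurableEquiv.piFinSuccAbove]; ring
    · simp [e, MeasurableEquiv.piFinSuccAbove]; ring

open MeasureTheory in
/-- The Prékopa–Leindler inequality for midpoints in Euclidean space. -/
theorem lintegral_mul_lintegral_le_euclideanSpace {n : ℕ} {u v m : EuclideanSpace ℝ (Fin n) → ENNReal}
    (hu : Measurable u) (hv : Measurable v) (hm : Measurable m)
    (h : ∀ x y, u x * v y ≤ m ((1 / 2 : ℝ) • (x + y)) ^ 2) :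
    (∫⁻ x, u x) * (∫⁻ x, v x) ≤ (∫⁻ x, m x) ^ 2 := by
  have he := PiLp.volume_preserving_toLp (Fin n)
  rw [← he.lintegral_comp hu, ← he.lintegral_comp hv, ← he.lintegral_comp hm]
  exact lintegral_mul_lintegral_le_pi n (hu.comp he.measurable) (hv.comp he.measurable)
    (hm.comp he.measurable) fun x y => h _ _

/-! ### Strong log-concavity and finite mass of the weighted Gaussian. -/

/-- The second derivative along the segment is nonnegative by the Hessian bound; its pointwise
existence suffices, without continuity. -/
theorem HessianBound.convexOn_segment {n : ℕ} {w : EuclideanSpace ℝ (Fin n) → ℝ} {K : ℝ}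
    (hK : HessianBound w K) (hconv : Convex ℝ (weightSupport w))
    (h1 : ∀ x ∈ weightSupport w, DifferentiableAt ℝ (fun y => Real.log (w y)) x)
    (h2 : ∀ x ∈ weightSupport w, DifferentiableAt ℝ (fderiv ℝ (fun y => Real.log (w y))) x)
    {x y : EuclideanSpace ℝ (Fin n)} (hx : x ∈ weightSupport w) (hy : y ∈ weightSupport w) :
    ConvexOn ℝ (Set.Icc (0 : ℝ) 1)
      (fun s => -Real.log (w (x + s • (y - x))) - K / 2 * s ^ 2 * ‖y - x‖ ^ 2) := by
  have hmem : ∀ s ∈ Set.Icc (0 : ℝ) 1, x + s • (y - x) ∈ weightSupport w := fun s hs =>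
    hconv.add_smul_sub_mem hx hy hs
  have hline : ∀ s : ℝ, HasDerivAt (fun s : ℝ => x + s • (y - x)) (y - x) s := fun s => by
    simpa using ((hasDerivAt_id s).smul_const (y - x)).const_add x
  have hd : ∀ s ∈ Set.Icc (0 : ℝ) 1,
      HasDerivAt (fun s => -Real.log (w (x + s • (y - x))) - K / 2 * s ^ 2 * ‖y - x‖ ^ 2)
        (-fderiv ℝ (fun z => Real.log (w z)) (x + s • (y - x)) (y - x) - K * s * ‖y - x‖ ^ 2) s :=
      fun s hs => by
    have e1 := ((h1 _ (hmem s hs)).hasFDerivAt.comp_hasDerivAt s (hline s)).neg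
    have e2 := (((hasDerivAt_id s).pow 2).const_mul (K / 2)).mul_const (‖y - x‖ ^ 2)
    refine (e1.sub e2).congr_deriv ?_
    simp only [id]
    ring
  refine convexOn_of_hasDerivWithinAt2_nonneg (convex_Icc 0 1)
    (f'' := fun s => -hessLog w (x + s • (y - x)) (y - x) - K * ‖y - x‖ ^ 2)
    (fun s hs => (hd s hs).continuousAt.continuousWithinAt)
    (fun s hs => (hd s (interior_subset hs)).hasDerivWithinAt) (fun s hs => ?_) (fun s hs => ?_)
  · have e0 : HasDerivAt
        (fun s : ℝ => fderiv ℝ (fun z => Real.log (w z)) (x + s • (y - x)))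
        (fderiv ℝ (fderiv ℝ (fun z => Real.log (w z))) (x + s • (y - x)) (y - x)) s :=
      (h2 _ (hmem s (interior_subset hs))).hasFDerivAt.comp_hasDerivAt s (hline s)
    have e1 : HasDerivAt
        (fun s : ℝ => -fderiv ℝ (fun z => Real.log (w z)) (x + s • (y - x)) (y - x))
        (-hessLog w (x + s • (y - x)) (y - x)) s :=
      (((ContinuousLinearMap.apply ℝ ℝ (y - x)).hasFDerivAt.comp_hasDerivAt s e0)).neg
    have e2 := ((hasDerivAt_id s).const_mul K).mul_const (‖y - x‖ ^ 2)
    refine ((e1.sub e2).congr_deriv ?_).hasDerivWithinAt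
    simp
  · exact sub_nonneg.2 (hK _ (hmem s (interior_subset hs)) (y - x))

theorem HessianBound.log_midpoint {n : ℕ} {w : EuclideanSpace ℝ (Fin n) → ℝ} {K : ℝ}
    (hK : HessianBound w K) (hconv : Convex ℝ (weightSupport w))
    (h1 : ∀ x ∈ weightSupport w, DifferentiableAt ℝ (fun y => Real.log (w y)) x)
    (h2 : ∀ x ∈ weightSupport w, DifferentiableAt ℝ (fderiv ℝ (fun y => Real.log (w y))) x)
    {x y : EuclideanSpace ℝ (Fin n)} (hx : x ∈ weightSupport w) (hy : y ∈ weightSupport w) :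
    Real.log (w x) + Real.log (w y) + K / 4 * ‖x - y‖ ^ 2 ≤
      2 * Real.log (w ((1 / 2 : ℝ) • (x + y))) := by
  have hc := hK.convexOn_segment hconv h1 h2 hx hy
  have h := hc.2 (Set.left_mem_Icc.2 zero_le_one)
    (Set.right_mem_Icc.2 zero_le_one) (show (0 : ℝ) ≤ 1 / 2 by norm_num)
    (show (0 : ℝ) ≤ 1 / 2 by norm_num) (by norm_num)
  have hmid : x + (1 / 2 : ℝ) • (y - x) = (1 / 2 : ℝ) • (x + y) := by module
  simp only [smul_eq_mul, mul_zero, mul_one, zero_add, zero_smul, one_smul, add_zero,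
    add_sub_cancel, hmid] at h
  rw [norm_sub_rev x y]
  linarith

/-- A convex function on the segment lies above its tangent at `s = 0`. This serves to dominate the
density by a Gaussian. -/
theorem HessianBound.log_le_tangent {n : ℕ} {w : EuclideanSpace ℝ (Fin n) → ℝ} {K : ℝ}
    (hK : HessianBound w K) (hconv : Convex ℝ (weightSupport w))
    (h1 : ∀ x ∈ weightSupport w, DifferentiableAt ℝ (fun y => Real.log (w y)) x)
    (h2 : ∀ x ∈ weightSupport w, DifferentiableAt ℝ (fderiv ℝ (fun y => Real.log (w y))) x)
    {x y : EuclideanSpace ℝ (Fin n)} (hx : x ∈ weightSupport w) (hy : y ∈ weightSupport w) :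
    Real.log (w y) ≤ Real.log (w x) + inner ℝ (gradient (fun z => Real.log (w z)) x) (y - x)
      - K / 2 * ‖y - x‖ ^ 2 := by
  have hline : HasDerivAt (fun s : ℝ => x + s • (y - x)) (y - x) 0 := by
    simpa using ((hasDerivAt_id (0 : ℝ)).smul_const (y - x)).const_add x
  have hd : HasDerivAt (fun s : ℝ => -Real.log (w (x + s • (y - x))) - K / 2 * s ^ 2 * ‖y - x‖ ^ 2)
      (-inner ℝ (gradient (fun z => Real.log (w z)) x) (y - x)) 0 := by
    have hf : HasFDerivAt (fun z => Real.log (w z)) (fderiv ℝ (fun z => Real.log (w z)) x)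
      (x + (0 : ℝ) • (y - x)) := by simpa using (h1 x hx).hasFDerivAt
    have e1 := (hf.comp_hasDerivAt 0 hline).neg
    have e2 := (((hasDerivAt_id (0 : ℝ)).pow 2).const_mul (K / 2)).mul_const (‖y - x‖ ^ 2)
    refine (e1.sub e2).congr_deriv ?_
    simp [gradient]
  have h := (hK.convexOn_segment hconv h1 h2 hx hy).le_slope_of_hasDerivAt
    (Set.left_mem_Icc.2 zero_le_one) (Set.right_mem_Icc.2 zero_le_one) zero_lt_one hd
  simp only [slope_def_field, zero_smul, one_smul, add_zero, add_sub_cancel, sub_zero, div_one,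
    one_pow, mul_one, mul_zero, zero_mul, ne_eq, OfNat.ofNat_ne_zero, not_false_eq_true,
    zero_pow] at h
  linarith

theorem weight_eq_zero_of_notMem {n : ℕ} {w : EuclideanSpace ℝ (Fin n) → ℝ}
    (h0 : ∀ x, 0 ≤ w x) {x : EuclideanSpace ℝ (Fin n)} (hx : x ∉ weightSupport w) : w x = 0 :=
  le_antisymm (not_lt.1 hx) (h0 x)

/-- Measurability of `w` is not assumed: `w = exp (log w)` is continuous on the open set `Σ` and
vanishes elsewhere. -/
theorem measurable_weight {n : ℕ} {w : EuclideanSpace ℝ (Fin n) → ℝ}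
    (h0 : ∀ x, 0 ≤ w x) (hopen : IsOpen (weightSupport w))
    (h1 : ∀ x ∈ weightSupport w, DifferentiableAt ℝ (fun y => Real.log (w y)) x) :
    Measurable w := by
  classical
  have h : w = (weightSupport w).piecewise (fun x => Real.exp (Real.log (w x))) 0 := by
    ext x
    by_cases hx : x ∈ weightSupport w
    · simp [hx, Real.exp_log hx]
    · simp [hx, weight_eq_zero_of_notMem h0 hx]
  rw [h]
  exact ContinuousOn.measurable_piecewise
    (fun x hx => (h1 x hx).continuousAt.rexp.continuousWithinAt) continuousOn_const
    hopen.measurableSet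

theorem unnormalizedMeasure_eq {n : ℕ} {w : EuclideanSpace ℝ (Fin n) → ℝ}
    (h0 : ∀ x, 0 ≤ w x) (hopen : IsOpen (weightSupport w)) :
    unnormalizedMeasure w = MeasureTheory.volume.withDensity
      fun x => ENNReal.ofReal (w x * Real.exp (-‖x‖ ^ 2 / 2)) := by
  rw [unnormalizedMeasure, ← MeasureTheory.withDensity_indicator hopen.measurableSet]
  congr 1
  ext x
  by_cases hx : x ∈ weightSupport w
  · simp [hx]
  · simp [hx, weight_eq_zero_of_notMem h0 hx]

open MeasureTheory in
theorem integrable_exp_neg_mul_norm_sq_add_inner {n : ℕ} {b : ℝ} (hb : 0 < b)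
    (a x₀ : EuclideanSpace ℝ (Fin n)) :
    Integrable fun y => Real.exp (-b * ‖y - x₀‖ ^ 2 + inner ℝ a (y - x₀)) := by
  have h := (GaussianFourier.integrable_cexp_neg_mul_sq_norm_add (b := (b : ℂ)) (by simpa) 1 a).norm
  refine Integrable.comp_sub_right (f := fun z => Real.exp (-b * ‖z‖ ^ 2 + inner ℝ a z)) ?_ x₀
  refine h.congr (Filter.Eventually.of_forall fun z => ?_)
  simp only [Complex.norm_exp]
  congr 1
  norm_cast
  simp

/-- Expanding `‖y‖²` around `x` adds `1` to `K` and `-x` to the gradient. For `K > -1` the right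
side is integrable in `y`, so the total mass is finite. -/
theorem HessianBound.density_le {n : ℕ} {w : EuclideanSpace ℝ (Fin n) → ℝ} {K : ℝ}
    (hK : HessianBound w K) (h0 : ∀ x, 0 ≤ w x) (hconv : Convex ℝ (weightSupport w))
    (h1 : ∀ x ∈ weightSupport w, DifferentiableAt ℝ (fun y => Real.log (w y)) x)
    (h2 : ∀ x ∈ weightSupport w, DifferentiableAt ℝ (fderiv ℝ (fun y => Real.log (w y))) x)
    {x : EuclideanSpace ℝ (Fin n)} (hx : x ∈ weightSupport w) (y : EuclideanSpace ℝ (Fin n)) :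
    w y * Real.exp (-‖y‖ ^ 2 / 2) ≤ w x * Real.exp (-‖x‖ ^ 2 / 2) *
      Real.exp (-((1 + K) / 2) * ‖y - x‖ ^ 2 +
        inner ℝ (gradient (fun z => Real.log (w z)) x - x) (y - x)) := by
  by_cases hy : y ∈ weightSupport w
  · have h := hK.log_le_tangent hconv h1 h2 hx hy
    rw [show w y = _ from (Real.exp_log hy).symm, show w x = _ from (Real.exp_log hx).symm,
      ← Real.exp_add, ← Real.exp_add, ← Real.exp_add, Real.exp_le_exp]
    have e : ‖y‖ ^ 2 = ‖x‖ ^ 2 + 2 * inner ℝ x (y - x) + ‖y - x‖ ^ 2 := by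
      rw [← norm_add_sq_real, add_sub_cancel]
    rw [inner_sub_left, e]
    linarith
  · rw [weight_eq_zero_of_notMem h0 hy, zero_mul]
    have := h0 x
    positivity

/-- The parallelogram identity makes the Gaussian factor contribute `1` to `K`. Outside `Σ` the left
side vanishes. -/
theorem HessianBound.density_midpoint {n : ℕ} {w : EuclideanSpace ℝ (Fin n) → ℝ} {K : ℝ}
    (hK : HessianBound w K) (h0 : ∀ x, 0 ≤ w x) (hconv : Convex ℝ (weightSupport w))
    (h1 : ∀ x ∈ weightSupport w, DifferentiableAt ℝ (fun y => Real.log (w y)) x)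
    (h2 : ∀ x ∈ weightSupport w, DifferentiableAt ℝ (fderiv ℝ (fun y => Real.log (w y))) x)
    (x y : EuclideanSpace ℝ (Fin n)) :
    (w x * Real.exp (-‖x‖ ^ 2 / 2)) * (w y * Real.exp (-‖y‖ ^ 2 / 2)) *
        Real.exp ((1 + K) / 4 * ‖x - y‖ ^ 2) ≤
      (w ((1 / 2 : ℝ) • (x + y)) * Real.exp (-‖(1 / 2 : ℝ) • (x + y)‖ ^ 2 / 2)) ^ 2 := by
  by_cases hx : x ∈ weightSupport w
  · by_cases hy : y ∈ weightSupport w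
    · have hm : (1 / 2 : ℝ) • (x + y) ∈ weightSupport w := by
        have := hconv hx hy (a := 1 / 2) (b := 1 / 2) (by norm_num) (by norm_num) (by norm_num)
        rwa [← smul_add] at this
      have h := hK.log_midpoint hconv h1 h2 hx hy
      have e : ‖(1 / 2 : ℝ) • (x + y)‖ ^ 2 = (‖x‖ ^ 2 + ‖y‖ ^ 2) / 2 - ‖x - y‖ ^ 2 / 4 := by
        rw [norm_smul, mul_pow, norm_add_sq_real, norm_sub_sq_real]
        norm_num
        ring
      rw [show w x = _ from (Real.exp_log hx).symm, show w y = _ from (Real.exp_log hy).symm,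
        show w ((1 / 2 : ℝ) • (x + y)) = _ from (Real.exp_log hm).symm, ← Real.exp_add,
        ← Real.exp_add, ← Real.exp_add, ← Real.exp_add, ← Real.exp_add, ← Real.exp_nat_mul,
        Real.exp_le_exp, e]
      push_cast
      linarith
    · rw [weight_eq_zero_of_notMem h0 hy]
      simp only [zero_mul, mul_zero]
      positivity
  · rw [weight_eq_zero_of_notMem h0 hx]
    simp only [zero_mul]
    positivity

open MeasureTheory in
theorem HessianBound.unnormalizedMeasure_univ_lt_top {n : ℕ} {w : EuclideanSpace ℝ (Fin n) → ℝ}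
    {K : ℝ} (hK : HessianBound w K) (hK1 : -1 < K) (h0 : ∀ x, 0 ≤ w x)
    (hne : (weightSupport w).Nonempty) (hopen : IsOpen (weightSupport w))
    (hconv : Convex ℝ (weightSupport w))
    (h1 : ∀ x ∈ weightSupport w, DifferentiableAt ℝ (fun y => Real.log (w y)) x)
    (h2 : ∀ x ∈ weightSupport w, DifferentiableAt ℝ (fderiv ℝ (fun y => Real.log (w y))) x) :
    unnormalizedMeasure w Set.univ < ⊤ := by
  obtain ⟨x, hx⟩ := hne
  rw [unnormalizedMeasure_eq h0 hopen, withDensity_apply _ MeasurableSet.univ, setLIntegral_univ]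
  refine lt_of_le_of_lt (lintegral_mono fun y => ENNReal.ofReal_le_ofReal
    (hK.density_le h0 hconv h1 h2 hx y)) ?_
  exact ((integrable_exp_neg_mul_norm_sq_add_inner (by linarith) _ x).const_mul _).lintegral_lt_top

open MeasureTheory in
theorem unnormalizedMeasure_univ_ne_zero {n : ℕ} {w : EuclideanSpace ℝ (Fin n) → ℝ}
    (h0 : ∀ x, 0 ≤ w x) (hne : (weightSupport w).Nonempty) (hopen : IsOpen (weightSupport w))
    (hw : Measurable w) :
    unnormalizedMeasure w Set.univ ≠ 0 := by
  rw [unnormalizedMeasure_eq h0 hopen, withDensity_apply _ MeasurableSet.univ, setLIntegral_univ,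
    ne_eq, lintegral_eq_zero_iff (by fun_prop)]
  intro h
  have hz : volume (weightSupport w) = 0 := measure_mono_null (fun x hx => by
    simpa using mul_pos hx (Real.exp_pos _)) h
  exact (hopen.measure_pos volume hne).ne' hz

/-! ### Second-order expansion of the exponential inequality. -/

theorem Real.exp_ge_quadratic_sub_cube {x : ℝ} (hx : |x| ≤ 1) :
    1 + x + x ^ 2 / 2 - |x| ^ 3 ≤ Real.exp x := by
  have h := (abs_le.1 (Real.exp_bound hx (n := 3) (by norm_num))).1
  norm_num [Finset.sum_range_succ, Nat.factorial] at h
  have : 0 ≤ |x| ^ 3 := by positivity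
  linarith

/-- In the expansion of `exp`, the cross term of the square costs `t³ κ M²`, its nonnegative `t⁴`
term is dropped, and the cubic remainder is at most `t³ (M + κ M)³`. The error is uniform in `a` and
`g`, so the bound can be integrated. -/
theorem exp_second_order_lower_bound {κ M : ℝ} (hκ : 0 ≤ κ) (hM : 0 ≤ M) {t : ℝ} (ht0 : 0 ≤ t)
    (ht1 : t ≤ 1) (htM : t * (M + κ * M) ≤ 1) {a g : ℝ} (ha : |a| ≤ M) (hg0 : 0 ≤ g) (hg : g ≤ M) :
    1 + t * a + t ^ 2 * (a ^ 2 / 2 - κ * g) - t ^ 3 * (κ * M ^ 2 + (M + κ * M) ^ 3) ≤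
      Real.exp (t * a - t ^ 2 * (κ * g)) := by
  have hκg : κ * g ≤ κ * M := mul_le_mul_of_nonneg_left hg hκ
  have hκg0 : 0 ≤ κ * g := mul_nonneg hκ hg0
  have hx : |t * a - t ^ 2 * (κ * g)| ≤ t * (M + κ * M) := by
    refine (abs_sub _ _).trans ?_
    rw [abs_mul, abs_of_nonneg ht0, abs_of_nonneg (by positivity : 0 ≤ t ^ 2 * (κ * g))]
    have : t ^ 2 * (κ * g) ≤ t * (κ * M) := by
      have : t ^ 2 ≤ t := by nlinarith
      exact mul_le_mul this hκg hκg0 ht0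
    nlinarith [mul_le_mul_of_nonneg_left ha ht0]
  have h := Real.exp_ge_quadratic_sub_cube (hx.trans htM)
  have h3 : |t * a - t ^ 2 * (κ * g)| ^ 3 ≤ t ^ 3 * (M + κ * M) ^ 3 := by
    rw [← mul_pow]
    exact pow_le_pow_left₀ (abs_nonneg _) hx 3
  have h4 : a * (κ * g) ≤ κ * M ^ 2 := by
    calc a * (κ * g) ≤ M * (κ * M) :=
          mul_le_mul ((le_abs_self a).trans ha) hκg hκg0 hM
      _ = κ * M ^ 2 := by ring
  have h5 := mul_le_mul_of_nonneg_left h4 (pow_nonneg ht0 3)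
  nlinarith [sq_nonneg (t ^ 2 * (κ * g))]

-- Expand the product, divide by `t²` and let `t` tend to `0` from the right.
open Filter in
theorem add_nonpos_of_eventually_mul_le_one {a b D : ℝ}
    (h : ∀ᶠ t in 𝓝[>] (0 : ℝ),
      (1 + t ^ 2 * a - t ^ 3 * D) * (1 + t ^ 2 * b - t ^ 3 * D) ≤ 1) : a + b ≤ 0 := by
  have hlim : Tendsto (fun t : ℝ => 2 * t * D - t ^ 2 * ((a - t * D) * (b - t * D))) (𝓝[>] 0)
      (𝓝 0) := by
    have hc : Continuous fun t : ℝ => 2 * t * D - t ^ 2 * ((a - t * D) * (b - t * D)) := by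
      fun_prop
    have := hc.tendsto 0
    simp only [mul_zero, zero_mul, ne_eq, OfNat.ofNat_ne_zero, not_false_eq_true, zero_pow,
      sub_zero] at this
    exact this.mono_left nhdsWithin_le_nhds
  refine ge_of_tendsto hlim ?_
  filter_upwards [h, self_mem_nhdsWithin] with t ht ht0
  have ht2 : 0 < t ^ 2 := pow_pos ht0 2
  refine le_of_mul_le_mul_left ?_ ht2
  linarith

-- Here `g` plays the role of `‖∇u‖²`. The first-order terms vanish because `f` has mean zero; at
-- order `t²` each factor contributes half of `∫ f²`, and the first also `-κ ∫ g`.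
open MeasureTheory Filter in
theorem integral_sq_le_of_integral_exp_mul_le_one {Ω : Type*} [MeasurableSpace Ω] {μ : Measure Ω}
    [IsProbabilityMeasure μ] {f g : Ω → ℝ} {κ M : ℝ} (hκ : 0 ≤ κ) (hf : Measurable f)
    (hg : Measurable g) (hfM : ∀ x, |f x| ≤ M) (hg0 : ∀ x, 0 ≤ g x) (hgM : ∀ x, g x ≤ M)
    (hmean : ∫ x, f x ∂μ = 0)
    (h : ∀ᶠ t in 𝓝[>] (0 : ℝ), (∫ x, Real.exp (t * f x - t ^ 2 * (κ * g x)) ∂μ) *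
      (∫ x, Real.exp (-(t * f x)) ∂μ) ≤ 1) :
    ∫ x, f x ^ 2 ∂μ ≤ κ * ∫ x, g x ∂μ := by
  obtain ⟨x₀⟩ : Nonempty Ω := nonempty_of_isProbabilityMeasure μ
  have hM : 0 ≤ M := (abs_nonneg _).trans (hfM x₀)
  have hbdd : ∀ {u : Ω → ℝ} (C : ℝ), Measurable u → (∀ x, |u x| ≤ C) → Integrable u μ :=
    fun C hu hC => Integrable.of_bound hu.aestronglyMeasurable C (Eventually.of_forall hC)
  have hfi : Integrable f μ := hbdd M hf hfM
  have hf2 : Integrable (fun x => f x ^ 2) μ := hbdd (M ^ 2) (hf.pow_const 2) fun x => by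
    rw [abs_pow]
    exact pow_le_pow_left₀ (abs_nonneg _) (hfM x) 2
  have hgi : Integrable g μ := hbdd M hg fun x => by rw [abs_of_nonneg (hg0 x)]; exact hgM x
  set R := M + κ * M
  set D := κ * M ^ 2 + R ^ 3
  have lower : ∀ (s : ℝ) (f' g' : Ω → ℝ), Integrable f' μ → Integrable (fun x => f' x ^ 2) μ →
      Integrable g' μ → Measurable f' → Measurable g' → (∀ x, |f' x| ≤ M) → (∀ x, 0 ≤ g' x) →
      (∀ x, g' x ≤ M) → ∫ x, f' x ∂μ = 0 → 0 ≤ s → s ≤ 1 → s * R ≤ 1 →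
      1 + s ^ 2 * ((∫ x, f' x ^ 2 ∂μ) / 2 - κ * ∫ x, g' x ∂μ) - s ^ 3 * D ≤
        ∫ x, Real.exp (s * f' x - s ^ 2 * (κ * g' x)) ∂μ := by
    intro s f' g' i1 i2 i3 m1 m2 b1 b2 b3 hz hs0 hs1 hsR
    have j1 : Integrable (fun x => 1 + s * f' x) μ := (integrable_const 1).add (i1.const_mul s)
    have j2 : Integrable (fun x => s ^ 2 * (f' x ^ 2 / 2 - κ * g' x)) μ :=
      ((i2.div_const 2).sub (i3.const_mul κ)).const_mul (s ^ 2)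
    have j3 : Integrable (fun x => 1 + s * f' x + s ^ 2 * (f' x ^ 2 / 2 - κ * g' x)) μ := j1.add j2
    have i4 : Integrable (fun x => 1 + s * f' x + s ^ 2 * (f' x ^ 2 / 2 - κ * g' x) - s ^ 3 * D) μ :=
      j3.sub (integrable_const _)
    have e : ∫ x, (1 + s * f' x + s ^ 2 * (f' x ^ 2 / 2 - κ * g' x) - s ^ 3 * D) ∂μ =
        1 + s ^ 2 * ((∫ x, f' x ^ 2 ∂μ) / 2 - κ * ∫ x, g' x ∂μ) - s ^ 3 * D := by
      rw [integral_sub j3 (integrable_const _), integral_add j1 j2,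
        integral_add (integrable_const 1) (i1.const_mul s), integral_const_mul, integral_const_mul,
        integral_sub (i2.div_const 2) (i3.const_mul κ), integral_const_mul, integral_div, hz]
      simp
    rw [← e]
    refine integral_mono i4 (hbdd (Real.exp 1) (by fun_prop) fun x => ?_) fun x =>
      exp_second_order_lower_bound hκ hM hs0 hs1 hsR (b1 x) (b2 x) (b3 x)
    rw [Real.abs_exp, Real.exp_le_exp]
    have h1 : s * f' x ≤ s * M := mul_le_mul_of_nonneg_left ((le_abs_self _).trans (b1 x)) hs0
    have h2 : s * M ≤ s * R := mul_le_mul_of_nonneg_left (le_add_of_nonneg_right (by positivity)) hs0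
    have h3 : 0 ≤ s ^ 2 * (κ * g' x) := by have := b2 x; positivity
    linarith
  have key := add_nonpos_of_eventually_mul_le_one (a := (∫ x, f x ^ 2 ∂μ) / 2 - κ * ∫ x, g x ∂μ)
    (b := (∫ x, f x ^ 2 ∂μ) / 2) (D := D) ?_
  · linarith
  have htend : ∀ c : ℝ → ℝ, Continuous c → c 0 < 1 → ∀ᶠ t in 𝓝[>] (0 : ℝ), c t < 1 :=
    fun c hc hc0 => ((hc.tendsto 0).eventually (gt_mem_nhds hc0)).filter_mono nhdsWithin_le_nhds
  filter_upwards [h, self_mem_nhdsWithin, htend (fun t => t) (by fun_prop) (by simp),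
    htend (fun t => t * R) (by fun_prop) (by simp),
    htend (fun t => t ^ 3 * D - t ^ 2 * ((∫ x, f x ^ 2 ∂μ) / 2)) (by fun_prop) (by simp)] with t ht ht0 ht1 htR hta
  have ht0' : (0 : ℝ) ≤ t := le_of_lt ht0
  have l1 := lower t f g hfi hf2 hgi hf hg hfM hg0 hgM hmean ht0' ht1.le htR.le
  have l2 := lower t (fun x => -f x) (fun _ => 0) hfi.neg (by simpa using hf2)
    (integrable_const 0) hf.neg measurable_const (by simpa using hfM) (fun _ => le_rfl)
    (fun _ => hM) (by rw [integral_neg, hmean, neg_zero]) ht0' ht1.le htR.le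
  simp only [neg_sq, integral_zero, mul_zero, sub_zero, mul_neg] at l2
  -- The lower bounds may be multiplied: `hta` makes the second one nonnegative for small `t`.
  exact (mul_le_mul l1 l2 (by linarith) (integral_nonneg fun x => (Real.exp_pos _).le)).trans
    (by simpa using ht)

/-! ### The Poincaré inequality for smooth compactly supported functions. -/

/-- A function with compact support and continuous second derivative satisfies a first order
Taylor bound with uniform constant. -/
theorem ContDiff.exists_taylor_bound {E : Type*} [NormedAddCommGroup E] [InnerProductSpace ℝ E]
    [CompleteSpace E] {u : E → ℝ} (hu : ContDiff ℝ 2 u) (hc : HasCompactSupport u) :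
    ∃ C : ℝ, 0 ≤ C ∧ ∀ x y, u x - u y ≤ ‖gradient u x‖ * ‖x - y‖ + C * ‖x - y‖ ^ 2 := by
  have hf : ContDiff ℝ 1 (fderiv ℝ u) := hu.fderiv_right (by norm_num)
  obtain ⟨C, hC⟩ := ContDiff.lipschitzWith_of_hasCompactSupport (hc.fderiv ℝ) hf (by simp)
  refine ⟨C, C.2, fun x y => ?_⟩
  have hd : ∀ z, HasFDerivAt u (fderiv ℝ u z) z := fun z =>
    (hu.differentiable (by norm_num) z).hasFDerivAt
  have h := (convex_segment x y).norm_image_sub_le_of_norm_hasFDerivWithin_le'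
    (f := u) (φ := fderiv ℝ u x) (C := C * ‖x - y‖)
    (fun z _ => (hd z).hasFDerivWithinAt) (fun z hz => ?_) (right_mem_segment ℝ x y)
    (left_mem_segment ℝ x y)
  · have h1 := (abs_le.1 h).2
    have h2 : fderiv ℝ u x (x - y) ≤ ‖gradient u x‖ * ‖x - y‖ := by
      refine (le_abs_self _).trans (((fderiv ℝ u x).le_opNorm _).trans_eq ?_)
      simp [gradient]
    nlinarith
  · refine (hC.norm_sub_le z x).trans ?_
    gcongr
    rw [norm_sub_rev x y]
    exact norm_sub_le_of_mem_segment hz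

open MeasureTheory Filter in
/-- The Poincaré inequality for measures whose density is strongly logarithmically concave in
the midpoint sense. -/
theorem poincare_of_midpoint_strongly_logConcave {n : ℕ} {ρ : EuclideanSpace ℝ (Fin n) → ℝ}
    {lam : ℝ} (hlam : 0 < lam) (hρ : Measurable ρ) (hρ0 : ∀ x, 0 ≤ ρ x)
    (hmid : ∀ x y, ρ x * ρ y * Real.exp (lam / 4 * ‖x - y‖ ^ 2) ≤ ρ ((1 / 2 : ℝ) • (x + y)) ^ 2)
    {μ : Measure (EuclideanSpace ℝ (Fin n))} [IsProbabilityMeasure μ] {c : ENNReal}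
    (hμ : μ = c • volume.withDensity fun x => ENNReal.ofReal (ρ x))
    {u : EuclideanSpace ℝ (Fin n) → ℝ} (hu : ContDiff ℝ 2 u) (hcs : HasCompactSupport u) :
    ∫ x, (u x - ∫ y, u y ∂μ) ^ 2 ∂μ ≤ 1 / lam * ∫ x, ‖gradient u x‖ ^ 2 ∂μ := by
  set m := ∫ y, u y ∂μ
  obtain ⟨C, hC0, hC⟩ := hu.exists_taylor_bound hcs
  have hgc : Continuous (gradient u) :=
    (InnerProductSpace.toDual ℝ _).symm.continuous.comp (hu.continuous_fderiv (by norm_num))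
  have hgs : HasCompactSupport (gradient u) :=
    (hcs.fderiv ℝ).comp_left (g := (InnerProductSpace.toDual ℝ _).symm) (map_zero _)
  obtain ⟨M₁, hM₁⟩ := hcs.exists_bound_of_continuous hu.continuous
  obtain ⟨M₂, hM₂⟩ := hgs.exists_bound_of_continuous hgc
  have hui : Integrable u μ :=
    Integrable.of_bound hu.continuous.aestronglyMeasurable M₁ (Eventually.of_forall hM₁)
  -- Prékopa–Leindler applied to exponential tilts of the density
  have hPL : ∀ φ ψ : EuclideanSpace ℝ (Fin n) → ℝ, Measurable φ → Measurable ψ →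
      Integrable (fun x => Real.exp (φ x)) μ → Integrable (fun x => Real.exp (ψ x)) μ →
      (∀ x y, φ x + ψ y ≤ lam / 4 * ‖x - y‖ ^ 2) →
      (∫ x, Real.exp (φ x) ∂μ) * (∫ x, Real.exp (ψ x) ∂μ) ≤ 1 := by
    intro φ ψ hφ hψ iφ iψ h
    have key := lintegral_mul_lintegral_le_euclideanSpace
      (u := fun x => ENNReal.ofReal (ρ x) * ENNReal.ofReal (Real.exp (φ x)))
      (v := fun x => ENNReal.ofReal (ρ x) * ENNReal.ofReal (Real.exp (ψ x)))
      (m := fun x => ENNReal.ofReal (ρ x)) (by fun_prop) (by fun_prop) (by fun_prop)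
      fun x y => by
        rw [← ENNReal.ofReal_mul (hρ0 x), ← ENNReal.ofReal_mul (hρ0 y),
          ← ENNReal.ofReal_mul (mul_nonneg (hρ0 x) (Real.exp_pos _).le),
          ← ENNReal.ofReal_pow (hρ0 _)]
        refine ENNReal.ofReal_le_ofReal (le_trans ?_ (hmid x y))
        rw [mul_mul_mul_comm, ← Real.exp_add]
        exact mul_le_mul_of_nonneg_left (Real.exp_le_exp.2 (h x y)) (mul_nonneg (hρ0 x) (hρ0 y))
    have e : ∀ η : EuclideanSpace ℝ (Fin n) → ℝ, Measurable η →
        ∫⁻ x, ENNReal.ofReal (Real.exp (η x)) ∂μ =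
          c * ∫⁻ x, ENNReal.ofReal (ρ x) * ENNReal.ofReal (Real.exp (η x)) := fun η hη => by
      rw [hμ, lintegral_smul_measure, lintegral_withDensity_eq_lintegral_mul _ (by fun_prop)
        (by fun_prop)]
      rfl
    have e1 : c * ∫⁻ x, ENNReal.ofReal (ρ x) = 1 := by
      rw [← measure_univ (μ := μ), hμ, Measure.smul_apply, withDensity_apply _ MeasurableSet.univ,
        setLIntegral_univ, smul_eq_mul]
    rw [← ENNReal.ofReal_le_ofReal_iff zero_le_one, ENNReal.ofReal_one,
      ENNReal.ofReal_mul (integral_nonneg fun x => (Real.exp_pos _).le),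
      ofReal_integral_eq_lintegral_ofReal iφ (Eventually.of_forall fun x => (Real.exp_pos _).le),
      ofReal_integral_eq_lintegral_ofReal iψ (Eventually.of_forall fun x => (Real.exp_pos _).le),
      e φ hφ, e ψ hψ, mul_mul_mul_comm]
    calc _ ≤ c * c * (∫⁻ x, ENNReal.ofReal (ρ x)) ^ 2 := by gcongr
      _ = (c * ∫⁻ x, ENNReal.ofReal (ρ x)) ^ 2 := by ring
      _ = 1 := by rw [e1, one_pow]
  have hκ : ∀ κ : ℝ, 1 / lam < κ →
      ∫ x, (u x - m) ^ 2 ∂μ ≤ κ * ∫ x, ‖gradient u x‖ ^ 2 ∂μ := by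
    intro κ hκ
    have hκ0 : 0 < κ := (one_div_pos.2 hlam).trans hκ
    have hb1 : ∀ x, |u x - m| ≤ max (M₁ + |m|) (M₂ ^ 2) := fun x =>
      ((abs_sub _ _).trans (add_le_add_left (hM₁ x) _)).trans (le_max_left _ _)
    have hb2 : ∀ x, ‖gradient u x‖ ^ 2 ≤ max (M₁ + |m|) (M₂ ^ 2) := fun x =>
      (pow_le_pow_left₀ (norm_nonneg _) (hM₂ x) 2).trans (le_max_right _ _)
    have hum : Measurable fun x => u x - m := (hu.continuous.sub continuous_const).measurable
    have hgm : Measurable fun x => ‖gradient u x‖ ^ 2 := (hgc.norm.pow 2).measurable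
    refine integral_sq_le_of_integral_exp_mul_le_one hκ0.le hum hgm hb1 (fun x => by positivity)
      hb2 ?_ ?_
    · rw [integral_sub hui (integrable_const _)]
      simp [m]
    -- Since `κ > 1 / lam`, this part of `lam / 4` is left over to absorb the Taylor error `t * C *
    -- ‖x - y‖²`.
    have hpos : 0 < (lam - 1 / κ) / 4 := by
      have : 1 / κ < lam := (one_div_lt hlam hκ0).1 hκ
      linarith
    have hev : ∀ᶠ t in 𝓝[>] (0 : ℝ), t * C < (lam - 1 / κ) / 4 := by
      have hct : Continuous fun t : ℝ => t * C := by fun_prop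
      exact ((hct.tendsto 0).eventually (gt_mem_nhds (by simpa using hpos))).filter_mono
        nhdsWithin_le_nhds
    filter_upwards [hev, self_mem_nhdsWithin] with t ht ht0
    have ht0' : 0 < t := ht0
    have hint : ∀ (η : EuclideanSpace ℝ (Fin n) → ℝ) (B : ℝ), Measurable η → (∀ x, η x ≤ B) →
        Integrable (fun x => Real.exp (η x)) μ := fun η B hη hB =>
      Integrable.of_bound (by fun_prop) (Real.exp B) (Eventually.of_forall fun x => by
        rw [Real.norm_eq_abs, Real.abs_exp, Real.exp_le_exp]; exact hB x)
    refine hPL _ _ (by fun_prop) (by fun_prop) (hint _ (t * max (M₁ + |m|) (M₂ ^ 2)) (by fun_prop)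
      fun x => ?_) (hint _ (t * max (M₁ + |m|) (M₂ ^ 2)) (by fun_prop) fun x => ?_) fun x y => ?_
    · have h1 := mul_le_mul_of_nonneg_left ((le_abs_self _).trans (hb1 x)) ht0'.le
      have h2 : 0 ≤ t ^ 2 * (κ * ‖gradient u x‖ ^ 2) := by positivity
      linarith
    · have h1 := mul_le_mul_of_nonneg_left ((neg_le_abs _).trans (hb1 x)) ht0'.le
      linarith
    · have h1 := mul_le_mul_of_nonneg_left (hC x y) ht0'.le
      have h2 := mul_le_mul_of_nonneg_right ht.le (sq_nonneg ‖x - y‖)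
      have h3 : t * (‖gradient u x‖ * ‖x - y‖) ≤
          t ^ 2 * (κ * ‖gradient u x‖ ^ 2) + 1 / κ / 4 * ‖x - y‖ ^ 2 := by
        -- Young's inequality with weight `κ`, by completing the square.
        have h4 : 0 ≤ κ * (t * ‖gradient u x‖ - 1 / κ / 2 * ‖x - y‖) ^ 2 := by positivity
        have h5 : κ * (t * ‖gradient u x‖ - 1 / κ / 2 * ‖x - y‖) ^ 2 =
            t ^ 2 * (κ * ‖gradient u x‖ ^ 2) + 1 / κ / 4 * ‖x - y‖ ^ 2 -
              t * (‖gradient u x‖ * ‖x - y‖) := by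
          field_simp
          ring
        linarith
      linarith
  have hlim : Tendsto (fun κ : ℝ => κ * ∫ x, ‖gradient u x‖ ^ 2 ∂μ) (𝓝[>] (1 / lam))
      (𝓝 (1 / lam * ∫ x, ‖gradient u x‖ ^ 2 ∂μ)) :=
    ((continuous_id.mul continuous_const).tendsto _).mono_left nhdsWithin_le_nhds
  refine ge_of_tendsto hlim ?_
  filter_upwards [self_mem_nhdsWithin] with κ h
  exact hκ κ h

/-! ### Application to the weighted Gaussian measure, with `lam = 1 + K_w`. -/

open MeasureTheory in
theorem isProbabilityMeasure_weightedGaussian {n : ℕ} {w : EuclideanSpace ℝ (Fin n) → ℝ}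
    (h0 : ∀ x, 0 ≤ w x) (hne : (weightSupport w).Nonempty) (hopen : IsOpen (weightSupport w))
    (hconv : Convex ℝ (weightSupport w)) (hstar : StarCondition w) :
    IsProbabilityMeasure (weightedGaussian w) := by
  obtain ⟨h1, h2, K, hK1, hK⟩ := hstar
  refine ⟨?_⟩
  rw [weightedGaussian, Measure.smul_apply, smul_eq_mul]
  exact ENNReal.inv_mul_cancel
    (unnormalizedMeasure_univ_ne_zero h0 hne hopen (measurable_weight h0 hopen h1))
    (hK.unnormalizedMeasure_univ_lt_top hK1 h0 hne hopen hconv h1 h2).ne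

theorem StarCondition.neg_one_lt_curvatureConst {n : ℕ} (hn : 1 ≤ n)
    {w : EuclideanSpace ℝ (Fin n) → ℝ} (hne : (weightSupport w).Nonempty) (hstar : StarCondition w) :
    -1 < curvatureConst w := by
  have hgr := isGreatest_curvatureConst hn w hne hstar
  obtain ⟨-, -, K, hK1, hK⟩ := hstar
  exact hK1.trans_le (hgr.2 hK)

open MeasureTheory in
theorem weightedGaussian_poincare {n : ℕ} (hn : 1 ≤ n) {w : EuclideanSpace ℝ (Fin n) → ℝ}
    (h0 : ∀ x, 0 ≤ w x) (hne : (weightSupport w).Nonempty) (hopen : IsOpen (weightSupport w))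
    (hconv : Convex ℝ (weightSupport w)) (hstar : StarCondition w)
    {u : EuclideanSpace ℝ (Fin n) → ℝ} (hu : ContDiff ℝ 2 u) (hcs : HasCompactSupport u) :
    ∫ x, (u x - ∫ y, u y ∂(weightedGaussian w)) ^ 2 ∂(weightedGaussian w) ≤
      1 / (1 + curvatureConst w) * ∫ x, ‖gradient u x‖ ^ 2 ∂(weightedGaussian w) := by
  have hK := (isGreatest_curvatureConst hn w hne hstar).1
  have hK1 := hstar.neg_one_lt_curvatureConst hn hne
  have := isProbabilityMeasure_weightedGaussian h0 hne hopen hconv hstar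
  have hm := measurable_weight h0 hopen hstar.1
  refine poincare_of_midpoint_strongly_logConcave (by linarith)
    (ρ := fun x => w x * Real.exp (-‖x‖ ^ 2 / 2)) (by fun_prop)
    (fun x => mul_nonneg (h0 x) (Real.exp_pos _).le)
    (HessianBound.density_midpoint hK h0 hconv hstar.1 hstar.2.1)
    (c := (unnormalizedMeasure w Set.univ)⁻¹) ?_ hu hcs
  rw [weightedGaussian]
  congr 1
  exact unnormalizedMeasure_eq h0 hopen

/-! ### Passage to the Sobolev class and to the exponent `q`. -/

open MeasureTheory in
theorem MeasureTheory.MemLp.eLpNorm_two_eq {α F : Type*} [MeasurableSpace α] {μ : Measure α}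
    [NormedAddCommGroup F] {f : α → F} (hf : MemLp f 2 μ) :
    eLpNorm f 2 μ = ENNReal.ofReal (√(∫ x, ‖f x‖ ^ 2 ∂μ)) := by
  rw [hf.eLpNorm_eq_integral_rpow_norm (by norm_num) (by norm_num), Real.sqrt_eq_rpow]
  norm_num

-- The factor `2` is not sharp, but the bound is only applied to errors `u k - f` that tend to zero.
open MeasureTheory in
theorem eLpNorm_two_sub_integral_le {α : Type*} [MeasurableSpace α] {μ : Measure α}
    [IsProbabilityMeasure μ] {f : α → ℝ} (hf : MemLp f 2 μ) :
    eLpNorm (fun x => f x - ∫ y, f y ∂μ) 2 μ ≤ 2 * eLpNorm f 2 μ := by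
  have h1 : eLpNorm (fun _ : α => ∫ y, f y ∂μ) 2 μ ≤ eLpNorm f 2 μ := by
    rw [eLpNorm_const _ (by norm_num) (IsProbabilityMeasure.ne_zero μ), measure_univ,
      ENNReal.one_rpow, mul_one]
    refine (enorm_integral_le_lintegral_enorm f).trans ?_
    rw [← eLpNorm_one_eq_lintegral_enorm]
    exact eLpNorm_le_eLpNorm_of_exponent_le (by norm_num) hf.aestronglyMeasurable
  rw [two_mul]
  exact (eLpNorm_sub_le hf.aestronglyMeasurable aestronglyMeasurable_const (by norm_num)).trans
    (by gcongr)

open MeasureTheory in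
theorem eLpNorm_poincare {E : Type*} [NormedAddCommGroup E] [InnerProductSpace ℝ E]
    [CompleteSpace E] [MeasurableSpace E] {μ : Measure E}
    [IsProbabilityMeasure μ] {u : E → ℝ} {c : ℝ} (hc : 0 ≤ c)
    (hu : MemLp u 2 μ) (hg : MemLp (gradient u) 2 μ)
    (h : ∫ x, (u x - ∫ y, u y ∂μ) ^ 2 ∂μ ≤ c * ∫ x, ‖gradient u x‖ ^ 2 ∂μ) :
    eLpNorm (fun x => u x - ∫ y, u y ∂μ) 2 μ ≤
      ENNReal.ofReal (√c) * eLpNorm (gradient u) 2 μ := by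
  have hv : MemLp (fun x => u x - ∫ y, u y ∂μ) 2 μ := hu.sub (memLp_const _)
  rw [hv.eLpNorm_two_eq, hg.eLpNorm_two_eq, ← ENNReal.ofReal_mul (Real.sqrt_nonneg _),
    ← Real.sqrt_mul hc]
  refine ENNReal.ofReal_le_ofReal (Real.sqrt_le_sqrt ?_)
  simpa only [Real.norm_eq_abs, sq_abs] using h

open MeasureTheory Filter in
/-- The Poincaré inequality passes to limits in `L^q`, `q ≥ 2`. -/
theorem eLpNorm_sub_integral_le_of_tendsto {α F : Type*} [MeasurableSpace α] {μ : Measure α}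
    [IsProbabilityMeasure μ] [NormedAddCommGroup F] {f : α → ℝ} {g : α → F} {q C : ENNReal}
    (hq : 2 ≤ q) (hC : C ≠ ⊤) (hf : MemLp f q μ) (hg : MemLp g q μ)
    {u : ℕ → α → ℝ} {v : ℕ → α → F} (hu : ∀ k, MemLp (u k) 2 μ) (hv : ∀ k, MemLp (v k) 2 μ)
    (h : ∀ k, eLpNorm (fun x => u k x - ∫ y, u k y ∂μ) 2 μ ≤ C * eLpNorm (v k) 2 μ)
    (huf : Tendsto (fun k => eLpNorm (fun x => u k x - f x) q μ) atTop (𝓝 0))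
    (hvg : Tendsto (fun k => eLpNorm (fun x => v k x - g x) q μ) atTop (𝓝 0)) :
    eLpNorm (fun x => f x - ∫ y, f y ∂μ) 2 μ ≤ C * eLpNorm g 2 μ := by
  have hf2 : MemLp f 2 μ := hf.mono_exponent hq
  have hg2 : MemLp g 2 μ := hg.mono_exponent hq
  have bound : ∀ k, eLpNorm (fun x => f x - ∫ y, f y ∂μ) 2 μ ≤
      2 * eLpNorm (fun x => u k x - f x) q μ +
        C * (eLpNorm (fun x => v k x - g x) q μ + eLpNorm g 2 μ) := by
    intro k
    have hd : MemLp (fun x => u k x - f x) 2 μ := (hu k).sub hf2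
    have hdv : MemLp (fun x => v k x - g x) 2 μ := (hv k).sub hg2
    have e : (fun x => f x - ∫ y, f y ∂μ) = (fun x => u k x - ∫ y, u k y ∂μ) -
        fun x => (u k x - f x) - ∫ y, (u k y - f y) ∂μ := by
      ext x
      rw [integral_sub ((hu k).integrable (by norm_num)) (hf2.integrable (by norm_num))]
      simp only [Pi.sub_apply]
      ring
    have hle : eLpNorm (v k) 2 μ ≤ eLpNorm (fun x => v k x - g x) 2 μ + eLpNorm g 2 μ := by
      have := eLpNorm_add_le hdv.aestronglyMeasurable hg2.aestronglyMeasurable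
        (p := 2) (by norm_num)
      refine le_trans (le_of_eq ?_) this
      congr 1
      ext x
      simp
    rw [e]
    refine (eLpNorm_sub_le ((hu k).sub (memLp_const _)).aestronglyMeasurable
      (hd.sub (memLp_const _)).aestronglyMeasurable (by norm_num)).trans ?_
    rw [add_comm]
    refine add_le_add ((eLpNorm_two_sub_integral_le hd).trans ?_) ((h k).trans ?_)
    · gcongr
      exact eLpNorm_le_eLpNorm_of_exponent_le hq hd.aestronglyMeasurable
    · gcongr
      refine hle.trans ?_
      gcongr
      exact eLpNorm_le_eLpNorm_of_exponent_le hq hdv.aestronglyMeasurable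
  have hlim : Tendsto (fun k => 2 * eLpNorm (fun x => u k x - f x) q μ +
      C * (eLpNorm (fun x => v k x - g x) q μ + eLpNorm g 2 μ)) atTop
      (𝓝 (2 * 0 + C * (0 + eLpNorm g 2 μ))) :=
    (ENNReal.Tendsto.const_mul huf (Or.inr (by norm_num))).add
      (ENNReal.Tendsto.const_mul (hvg.add tendsto_const_nhds) (Or.inr hC))
  have := ge_of_tendsto' hlim bound
  simpa using this

theorem theorem1p3 (n : ℕ) (hn : 1 ≤ n) (w : EuclideanSpace ℝ (Fin n) → ℝ)
    (hw_nonneg : ∀ x, 0 ≤ w x)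
    (h_nonempty : (weightSupport w).Nonempty)
    (h_open : IsOpen (weightSupport w))
    (h_convex : Convex ℝ (weightSupport w))
    (h_star : StarCondition w) :
    MeasureTheory.IsProbabilityMeasure (weightedGaussian w) ∧
    ∀ (q : ℝ), 2 ≤ q →
      ∀ (f : EuclideanSpace ℝ (Fin n) → ℝ)
        (g : EuclideanSpace ℝ (Fin n) → EuclideanSpace ℝ (Fin n)),
        IsSobolevWithGradient w q f g →
        ∫ x, |f x - ∫ y, f y ∂(weightedGaussian w)| ^ 2 ∂(weightedGaussian w) ≤
          1 / (1 + curvatureConst w) *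
            (∫ x, ‖g x‖ ^ q ∂(weightedGaussian w)) ^ (2 / q) := by
  have hprob := isProbabilityMeasure_weightedGaussian hw_nonneg h_nonempty h_open h_convex h_star
  refine ⟨hprob, fun q hq f g ⟨hf, hg, u, hu, huf, hvg⟩ => ?_⟩
  set μ := weightedGaussian w
  have hq0 : 0 < q := by linarith
  have hq2 : (2 : ENNReal) ≤ ENNReal.ofReal q := by
    rw [← ENNReal.ofReal_ofNat]
    exact ENNReal.ofReal_le_ofReal hq
  have hc : 0 ≤ 1 / (1 + curvatureConst w) := by
    have := h_star.neg_one_lt_curvatureConst hn h_nonempty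
    exact one_div_nonneg.2 (by linarith)
  have hu2 : ∀ k, ContDiff ℝ 2 (u k) := fun k => (hu k).1.of_le (WithTop.coe_le_coe.2 le_top)
  have hum : ∀ k, MeasureTheory.MemLp (u k) 2 μ := fun k =>
    (hu k).1.continuous.memLp_of_hasCompactSupport (hu k).2.1
  have hgm : ∀ k, MeasureTheory.MemLp (gradient (u k)) 2 μ := fun k =>
    ((InnerProductSpace.toDual ℝ _).symm.continuous.comp
      ((hu2 k).continuous_fderiv (by norm_num))).memLp_of_hasCompactSupport
      (((hu k).2.1.fderiv ℝ).comp_left (g := (InnerProductSpace.toDual ℝ _).symm) (map_zero _))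
  have hmain := eLpNorm_sub_integral_le_of_tendsto hq2 ENNReal.ofReal_ne_top hf hg hum hgm
    (fun k => eLpNorm_poincare hc (hum k) (hgm k) (weightedGaussian_poincare hn hw_nonneg
      h_nonempty h_open h_convex h_star (hu2 k) (hu k).2.1)) huf hvg
  have hfv : MeasureTheory.MemLp (fun x => f x - ∫ y, f y ∂μ) 2 μ :=
    (hf.mono_exponent hq2).sub (MeasureTheory.memLp_const _)
  -- On a probability space the `L²` norm of the gradient is at most its `L^q` norm.
  have hstep := hmain.trans (mul_le_mul_right
    (MeasureTheory.eLpNorm_le_eLpNorm_of_exponent_le hq2 hg.aestronglyMeasurable) _)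
  have hI : 0 ≤ ∫ x, ‖g x‖ ^ q ∂μ :=
    MeasureTheory.integral_nonneg fun x => Real.rpow_nonneg (norm_nonneg _) _
  rw [hfv.eLpNorm_two_eq, hg.eLpNorm_eq_integral_rpow_norm (by simpa using hq0)
    ENNReal.ofReal_ne_top, ENNReal.toReal_ofReal hq0.le,
    ← ENNReal.ofReal_mul (Real.sqrt_nonneg _), ENNReal.ofReal_le_ofReal_iff (by positivity)] at hstep
  have hsq := pow_le_pow_left₀ (Real.sqrt_nonneg _) hstep 2
  rw [mul_pow, Real.sq_sqrt hc, Real.sq_sqrt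
    (MeasureTheory.integral_nonneg fun x => sq_nonneg _), ← Real.rpow_natCast (_ ^ _) 2,
    ← Real.rpow_mul hI] at hsq
  refine hsq.trans_eq ?_
  congr 2
  push_cast
  field_simp
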